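/- **Model.** A *network* on $n$ nodes is an undirected simple graph with $n$ nodes, in which the edges at each node $v$ are numbered by ports $0,\dots,\deg(v)-1$ (in an arbitrary way), and in which the nodes carry pairwise distinct IDs from $\{1,\dots,N\}$. A *randomized algorithm* runs in synchronous rounds. Initially all nodes are awake and each node knows only the network size $n$, its own ID, its own degree, and its own private infinite sequence of independent unbiased coin flips. In every round each node may send one message of arbitrary size through each of its ports, receives the messages sent to it in this round (knowing through which ports they arrive), and updates its local state by an arbitrary (measurable) local computation. Each node has a variable $\mathtt{status}\in\{\bot,\text{NON-ELECTED},\text{ELECTED}\}$, initially $\bot$. An execution *solves implicit leader election* if there is a round $T$ such that from round $T$ on exactly one node has status ELECTED and all other nodes have status NON-ELECTED. **Theorem.** For every constant $\varepsilon>0$ there are constants $c>0$ and $n_0$, depending only on $\varepsilon$, such that the following holds for all $n\ge n_0$ and all $N\ge n^4$. Let $A$ be a randomized algorithm (it may depend on $n$ and $N$) that solves implicit leader election with probability at least $\frac12+\varepsilon$ on every $n$-node network of diameter at most $2$ with distinct IDs from $\{1,\dots,N\}$. Then there is an $n$-node network of diameter at most $2$ with distinct IDs from $\{1,\dots,N\}$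 on which the expected total number of messages that $A$ sends, over all rounds, is at least $c\,n$. There is no restriction on the number of rounds. -/

import Mathlib

open MeasureTheory
open scoped ENNReal

namespace LeaderElection

/-- Messages are bit strings of arbitrary length. -/
abbrev Msg : Type := List Bool

/-- The values of the variable `status` of a node (`undecided` is `⊥`). -/
inductive Status : Type
  | undecided
  | nonElected
  | elected

/-- A network on `n` nodes: an undirected simple graph, a port numbering at every node (the ports of
`v` are `0, …, deg v - 1`, in bijection with the neighbours of `v`), and pairwise distinct IDs
in `{1, …, N}`. The type `Fin n` of nodes is only used for bookkeeping and is not accessible to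
algorithms. -/
structure Network (n N : ℕ) where
  graph : SimpleGraph (Fin n)
  deg : Fin n → ℕ
  port : (v : Fin n) → Fin (deg v) ≃ graph.neighborSet v
  id : Fin n → ℕ
  id_injective : Function.Injective id
  id_mem : ∀ v, id v ∈ Set.Icc 1 N

namespace Network

variable {n N : ℕ}

/-- The neighbour of `v` behind port `i`. -/
def nbr (net : Network n N) (v : Fin n) (i : Fin (net.deg v)) : Fin n :=
  (net.port v i).1

/-- The port number, at the neighbour of `v` behind port `i`, of the edge between the two. -/
def backPort (net : Network n N) (v : Fin n) (i : Fin (net.deg v)) :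
    Fin (net.deg (net.nbr v i)) :=
  (net.port (net.nbr v i)).symm ⟨v, (net.port v i).2.symm⟩

end Network

/-- A randomized synchronous distributed algorithm, in the port numbering model without initial
knowledge of the neighbours. A node starts with the network size `n`, its own ID, its own degree and
an infinite tape of private coin flips, from which its initial local state is computed. In every
round a node of degree `d` in state `s` sends `send d s i` through port `i` (`none` means that no
message is sent), and then updates its state using the messages it receives in this round, which it
sees according to the ports they arrive through. Local computation is not restricted, apart from
measurability. -/
structure Algorithm where
  State : Type
  [measurableSpace : MeasurableSpace State]
  init : (n id d : ℕ) → (ℕ → Bool) → State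
  send : (d : ℕ) → State → Fin d → Option Msg
  recv : (d : ℕ) → State → (Fin d → Option Msg) → State
  status : State → Status
  status_init : ∀ n id d coins, status (init n id d coins) = Status.undecided
  measurable_init : ∀ n id d, Measurable (init n id d)
  measurable_send : ∀ d i m, MeasurableSet {s | send d s i = m}
  measurable_recv : ∀ d inbox, Measurable fun s => recv d s inbox
  measurable_status : ∀ x, MeasurableSet {s | status s = x}

/-- The law of one infinite sequence of independent unbiased coin flips. -/
noncomputable def tapeMeasure : Measure (ℕ → Bool) :=
  Measure.infinitePi fun _ : ℕ => (PMF.uniformOfFintype Bool).toMeasure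

/-- The law of the private coin flips of `n` nodes: independent tapes, one for each node. -/
noncomputable def coinMeasure (n : ℕ) : Measure (Fin n → ℕ → Bool) :=
  Measure.pi fun _ : Fin n => tapeMeasure

namespace Algorithm

variable {n N : ℕ}

/-- The local states of all nodes after `t` rounds, for the coin flips `ω`. The message that `v`
receives through port `i` is the one sent in the same round by the neighbour behind port `i` through
the other end of that edge. -/
def run (A : Algorithm) (net : Network n N) (ω : Fin n → ℕ → Bool) : ℕ → Fin n → A.State
  | 0 => fun v => A.init n (net.id v) (net.deg v) (ω v)
  | t + 1 => fun v => A.recv (net.deg v) (A.run net ω t v) fun i =>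
      A.send (net.deg (net.nbr v i)) (A.run net ω t (net.nbr v i)) (net.backPort v i)

/-- After `t` rounds exactly one node is elected and all other nodes are non-elected. -/
def OneLeader (A : Algorithm) (net : Network n N) (ω : Fin n → ℕ → Bool) (t : ℕ) : Prop :=
  ∃ v, A.status (A.run net ω t v) = Status.elected ∧
    ∀ u, u ≠ v → A.status (A.run net ω t u) = Status.nonElected

/-- The execution solves implicit leader election in some number `T` of rounds: from round `T` on,
exactly one node is elected and all other nodes are non-elected. -/
def Solves (A : Algorithm) (net : Network n N) (ω : Fin n → ℕ → Bool) : Prop :=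
  ∃ T, ∀ t, T ≤ t → A.OneLeader net ω t

/-- The number of messages that are sent in round `t + 1`. -/
def messagesInRound (A : Algorithm) (net : Network n N) (ω : Fin n → ℕ → Bool) (t : ℕ) : ℕ :=
  ∑ v : Fin n, ∑ i : Fin (net.deg v),
    if (A.send (net.deg v) (A.run net ω t v) i).isSome then 1 else 0

/-- The total number of messages sent during the whole (infinite) execution. -/
noncomputable def messages (A : Algorithm) (net : Network n N) (ω : Fin n → ℕ → Bool) : ℝ≥0∞ :=
  ∑' t : ℕ, (A.messagesInRound net ω t : ℝ≥0∞)

/-- The probability that the algorithm solves implicit leader election. -/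
noncomputable def successProb (A : Algorithm) (net : Network n N) : ℝ :=
  (coinMeasure n).real {ω | A.Solves net ω}

/-- The expected total number of messages. -/
noncomputable def expectedMessages (A : Algorithm) (net : Network n N) : ℝ≥0∞ :=
  ∫⁻ ω, A.messages net ω ∂coinMeasure n

end Algorithm

end LeaderElection

/-!
Suppose that few messages are sent, and take two disjoint cliques on `m + k + 1` nodes. Replace
`k + 1` nodes at random places in each of them by `k + 1` hubs that the two sides share. This gives
a network of diameter `2` on `n = 2 * m + k + 1` nodes (with one or two hubs, according to the
parity of `n`). As long as no message crosses a hub, each private node behaves as in its own clique.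
A crossing is unlikely: the few messages in the disjoint cliques rarely concern the nodes that were
replaced, and the hubs can be chosen such that they most likely send nothing before they hear
something and have probability at most `1 / 2` of being elected unless they do. Indeed, in a clique
on `n` nodes with few messages most nodes neither send nor receive any, and most are unlikely to be
elected.

Without crossings the two sides and the hubs are independent. Give an elected node the sign `-1` and
every other node the sign `1`: if there is exactly one leader, then the product of all signs is
`-1`. But its expectation is the product of one factor per side and one factor per hub. The factors
of the hubs are nonnegative, and of any three cliques two have factors of the same sign. With these
two as sides the expectation is nonnegative, so the product is `-1` with probability at most
`1 / 2`.
-/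

open ProbabilityTheory
open scoped BigOperators

namespace LeaderElection

/-! ### Averages over finite types -/

section Average

open Finset

variable {α β ι : Type*} [Fintype α] [Fintype β] [Fintype ι] [DecidableEq ι]

lemma expect_equiv_apply [DecidableEq α] [DecidableEq β] [Nonempty (α ≃ β)] (f : β → ℝ) (a : α) :
    𝔼 σ : α ≃ β, f (σ a) = 𝔼 b, f b := by
  have hswap : ∀ a', 𝔼 σ : α ≃ β, f (σ a') = 𝔼 σ : α ≃ β, f (σ a) := fun a' =>
    Fintype.expect_equiv ((Equiv.swap a a').equivCongr (.refl β)) _ _ fun σ => by simp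
  have : Nonempty α := ⟨a⟩
  calc 𝔼 σ : α ≃ β, f (σ a) = 𝔼 a', 𝔼 σ : α ≃ β, f (σ a') := by
        simp only [hswap, Fintype.expect_const]
    _ = 𝔼 σ : α ≃ β, 𝔼 a', f (σ a') := expect_comm _ _ _
    _ = 𝔼 _σ : α ≃ β, 𝔼 b, f b :=
        expect_congr rfl fun σ _ => Fintype.expect_equiv σ _ _ fun _ => rfl
    _ = 𝔼 b, f b := Fintype.expect_const _

lemma expect_prod_apply (f : ι → α → ℝ) :
    𝔼 x : ι → α, ∏ i, f i (x i) = ∏ i, 𝔼 a, f i a := by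
  simp only [Fintype.expect_eq_sum_div_card, prod_div_distrib, prod_univ_sum,
    Fintype.piFinset_univ, prod_const, Fintype.card_fun, card_univ, Nat.cast_pow]

lemma expect_eval [Nonempty α] (f : α → ℝ) (i : ι) : 𝔼 x : ι → α, f (x i) = 𝔼 a, f a := by
  have h := expect_prod_apply fun j a => if j = i then f a else 1
  have hj : ∀ j, 𝔼 a, (if j = i then f a else 1) = if j = i then 𝔼 a, f a else 1 := fun j => by
    split_ifs
    exacts [rfl, Fintype.expect_const 1]
  simpa only [hj, prod_ite_eq', mem_univ, if_true] using h

end Average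

/-! ### Probability -/

section Probability

variable {Ω ι κ ν α : Type*} [MeasurableSpace Ω] [MeasurableSpace α]

lemma integral_expect [Fintype ι] {μ : Measure Ω} {f : ι → Ω → ℝ}
    (hf : ∀ i, Integrable (f i) μ) : ∫ ω, 𝔼 i, f i ω ∂μ = 𝔼 i, ∫ ω, f i ω ∂μ := by
  simp only [Fintype.expect_eq_sum_div_card, integral_div,
    integral_finsetSum _ fun i _ => hf i]

lemma expect_measureReal_le [Fintype ι] (μ : Measure Ω) [IsProbabilityMeasure μ] {S : ι → Set Ω}
    {c : ℝ} (hS : ∀ i, MeasurableSet (S i))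
    (h : ∀ ω, 𝔼 i, (S i).indicator (1 : Ω → ℝ) ω ≤ c) : 𝔼 i, μ.real (S i) ≤ c := by
  have hint : ∀ i, Integrable ((S i).indicator (1 : Ω → ℝ)) μ := fun i =>
    (integrable_const 1).indicator (hS i)
  calc 𝔼 i, μ.real (S i) = ∫ ω, 𝔼 i, (S i).indicator (1 : Ω → ℝ) ω ∂μ := by
        simp only [integral_expect hint, integral_indicator_one (hS _)]
    _ ≤ ∫ _, c ∂μ := integral_mono (by
        simpa only [Fintype.expect_eq_sum_div_card] using
          (integrable_finsetSum _ fun i _ => hint i).div_const _) (integrable_const c) h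
    _ = c := by simp

lemma measureReal_eq_neg_one_le (μ : Measure Ω) [IsProbabilityMeasure μ] {f : Ω → ℝ}
    (hf : Measurable f) (h : ∀ ω, |f ω| ≤ 1) :
    μ.real {ω | f ω = -1} ≤ (1 - ∫ ω, f ω ∂μ) / 2 := by
  have hint : Integrable f μ := .of_bound hf.aestronglyMeasurable 1 (.of_forall h)
  have hmarkov := mul_meas_ge_le_integral_of_nonneg (μ := μ) (f := fun ω => 1 - f ω)
    (.of_forall fun ω => sub_nonneg.mpr (abs_le.mp (h ω)).2) ((integrable_const 1).sub hint) 2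
  have hsub : {ω | f ω = -1} ⊆ {ω | 2 ≤ 1 - f ω} := fun ω (hω : f ω = -1) => by
    simp only [Set.mem_ofPred_eq, hω]; norm_num
  rw [integral_sub (integrable_const 1) hint, integral_const, probReal_univ, one_smul] at hmarkov
  linarith [measureReal_mono (μ := μ) hsub]

lemma measurePreserving_precomp [Fintype ι] [Fintype κ] (μ : Measure α) [IsProbabilityMeasure μ]
    {g : κ → ι} (hg : Function.Injective g) :
    MeasurePreserving (fun (ω : ι → α) k => ω (g k)) (.pi fun _ => μ) (.pi fun _ => μ) := by
  have hind := (iIndepFun_pi (μ := fun _ : ι => μ) (X := fun _ => id)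
    fun _ => aemeasurable_id).precomp hg
  refine ⟨measurable_pi_lambda _ fun k => measurable_pi_apply _, ?_⟩
  refine (hind.map_fun_eq_pi_map fun k => (measurable_pi_apply (g k)).aemeasurable).trans ?_
  exact congrArg _ <| funext fun k => (measurePreserving_eval (fun _ : ι => μ) (g k)).map_eq

lemma measurePreserving_sumElim_uncurry [Fintype ι] [Fintype κ] [Fintype ν] (μ : Measure α)
    [IsProbabilityMeasure μ] :
    MeasurePreserving
      (fun (ω : (ι → κ → α) × (ν → α)) => (Sum.elim (Function.uncurry ω.1) ω.2 : ι × κ ⊕ ν → α))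
      ((Measure.pi fun _ => .pi fun _ => μ).prod (.pi fun _ => μ)) (.pi fun _ => μ) := by
  have hmeas : Measurable fun (ω : (ι → κ → α) × (ν → α)) =>
      (Sum.elim (Function.uncurry ω.1) ω.2 : ι × κ ⊕ ν → α) :=
    measurable_pi_lambda _ <| by
      rintro (⟨i, k⟩ | j) <;> simp only [Sum.elim_inl, Sum.elim_inr, Function.uncurry] <;> fun_prop
  refine ⟨hmeas, (Measure.pi_eq fun s hs => ?_).symm⟩
  have hbox : (fun (ω : (ι → κ → α) × (ν → α)) =>
        (Sum.elim (Function.uncurry ω.1) ω.2 : ι × κ ⊕ ν → α)) ⁻¹' Set.univ.pi s =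
      (Set.univ.pi fun i => Set.univ.pi fun k => s (.inl (i, k))) ×ˢ
        Set.univ.pi fun j => s (.inr j) := by
    ext ω
    simp [Set.mem_pi, Sum.forall, Prod.forall, Function.uncurry]
  rw [Measure.map_apply hmeas (.univ_pi hs), hbox, Measure.prod_prod]
  simp [Measure.pi_pi, Fintype.prod_sum_type, Fintype.prod_prod_type]

end Probability

lemma exists_mul_nonneg (a : Fin 3 → ℝ) : ∃ i j, i ≠ j ∧ 0 ≤ a i * a j := by
  obtain ⟨i, j, hij, h⟩ := Fintype.exists_ne_map_eq_of_card_lt (fun i => decide (0 ≤ a i)) (by simp)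
  refine ⟨i, j, hij, ?_⟩
  rw [decide_eq_decide] at h
  by_cases hi : 0 ≤ a i
  · exact mul_nonneg hi (h.mp hi)
  · exact (mul_pos_of_neg_of_neg (not_le.mp hi) (not_le.mp (h.not.mp hi))).le

/-! ### Executions -/

namespace Network

variable {n N : ℕ} (net : Network n N)

lemma nbr_injective (v : Fin n) : Function.Injective (net.nbr v) :=
  Subtype.val_injective.comp (net.port v).injective

@[simp]
lemma nbr_backPort (v : Fin n) (i : Fin (net.deg v)) :
    net.nbr (net.nbr v i) (net.backPort v i) = v :=
  congrArg Subtype.val (Equiv.apply_symm_apply (net.port (net.nbr v i)) _)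

lemma backPort_injective : Function.Injective
    (fun d : Σ v, Fin (net.deg v) =>
      (⟨net.nbr d.1 d.2, net.backPort d.1 d.2⟩ : Σ v, Fin (net.deg v))) := by
  rintro ⟨v, i⟩ ⟨w, j⟩ h
  have hvw := congrArg (fun d : Σ v, Fin (net.deg v) => net.nbr d.1 d.2) h
  simp only [nbr_backPort] at hvw
  subst hvw
  obtain rfl : i = j := net.nbr_injective v (congrArg Sigma.fst h)
  rfl

lemma sum_nbr_backPort (f : (v : Fin n) → Fin (net.deg v) → ℕ) :
    ∑ v, ∑ i, f (net.nbr v i) (net.backPort v i) = ∑ v, ∑ i, f v i := by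
  rw [← Fintype.sum_sigma', ← Fintype.sum_sigma']
  exact (Finite.injective_iff_bijective.mp net.backPort_injective).sum_comp fun d => f d.1 d.2

/-- The lists of neighbours, in the order of the ports, and the IDs: these determine the network. -/
def encoding : (Fin n → {l : List (Fin n) // l.Nodup}) × (Fin n → Set.Icc 1 N) :=
  (fun v => ⟨.ofFn (net.nbr v), List.nodup_ofFn.mpr (net.nbr_injective v)⟩,
    fun v => ⟨net.id v, net.id_mem v⟩)

lemma encoding_injective : Function.Injective (encoding (n := n) (N := N)) := by
  rintro ⟨G, deg, port, id, hinj, hmem⟩ ⟨G', deg', port', id', hinj', hmem'⟩ h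
  obtain ⟨hlist, hid⟩ := Prod.ext_iff.mp h
  have hlist' : ∀ v, List.ofFn (fun i => (port v i).1) = List.ofFn fun i => (port' v i).1 :=
    fun v => congrArg Subtype.val (congrFun hlist v)
  obtain rfl : id = id' := funext fun v => congrArg Subtype.val (congrFun hid v)
  obtain rfl : deg = deg' := funext fun v => by simpa using congrArg List.length (hlist' v)
  have hport : ∀ v i, (port v i).1 = (port' v i).1 := fun v =>
    congrFun (List.ofFn_injective (hlist' v))
  obtain rfl : G = G' := by
    ext v w
    constructor
    · intro hw
      simpa [← hport] using (port' v ((port v).symm ⟨w, hw⟩)).2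
    · intro hw
      simpa [hport] using (port v ((port' v).symm ⟨w, hw⟩)).2
  obtain rfl : port = port' := funext fun v => Equiv.ext fun i => Subtype.ext (hport v i)
  rfl

instance : Finite (Network n N) := .of_injective _ encoding_injective

end Network

namespace Algorithm

variable {n N : ℕ} (A : Algorithm)

instance : MeasurableSpace A.State := A.measurableSpace

/-- The algorithm that behaves as `A` does on a network of size `n`, whatever the size of the
network is. It is run on components that are smaller than the network they are cut out of. -/
def withSize (n : ℕ) : Algorithm where
  State := A.State
  init _ := A.init n
  send := A.send
  recv := A.recv
  status := A.status
  status_init _ := A.status_init n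
  measurable_init _ := A.measurable_init n
  measurable_send := A.measurable_send
  measurable_recv := A.measurable_recv
  measurable_status := A.measurable_status

/-- The number of messages that a node of degree `d` in state `s` sends. -/
def sends (d : ℕ) (s : A.State) : ℕ := ∑ i : Fin d, if (A.send d s i).isSome then 1 else 0

/-- The messages that `v` receives in round `t + 1`, by the port they arrive through. -/
def inbox (net : Network n N) (ω : Fin n → ℕ → Bool) (t : ℕ) (v : Fin n) :
    Fin (net.deg v) → Option Msg := fun i =>
  A.send (net.deg (net.nbr v i)) (A.run net ω t (net.nbr v i)) (net.backPort v i)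

/-- The number of messages sent in the first `T` rounds. -/
def messagesBefore (net : Network n N) (ω : Fin n → ℕ → Bool) (T : ℕ) : ℕ :=
  ∑ t ∈ Finset.range T, A.messagesInRound net ω t

/-- The number of messages that `v` sends or receives in the first `T` rounds. -/
def traffic (net : Network n N) (ω : Fin n → ℕ → Bool) (T : ℕ) (v : Fin n) : ℕ :=
  ∑ t ∈ Finset.range T, (A.sends (net.deg v) (A.run net ω t v) +
    ∑ i, if (A.inbox net ω t v i).isSome then 1 else 0)

/-- The local states of a node that never receives a message. -/
def silentRun (n id d : ℕ) (c : ℕ → Bool) : ℕ → A.State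
  | 0 => A.init n id d c
  | t + 1 => A.recv d (silentRun n id d c t) fun _ => none

/-- A node with coin flips `c` that receives no messages sends none in the first `T` rounds. -/
def Quiet (n id d T : ℕ) (c : ℕ → Bool) : Prop :=
  ∀ t < T, ∀ i, A.send d (A.silentRun n id d c t) i = none

section Run

variable {net : Network n N} {ω : Fin n → ℕ → Bool}

lemma run_succ (t : ℕ) (v : Fin n) :
    A.run net ω (t + 1) v = A.recv (net.deg v) (A.run net ω t v) (A.inbox net ω t v) := rfl

lemma inbox_eq_send {u v : Fin n} {i : Fin (net.deg v)} {j : Fin (net.deg u)}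
    (hi : net.nbr v i = u) (hj : net.nbr u j = v) (t : ℕ) :
    A.inbox net ω t v i = A.send (net.deg u) (A.run net ω t u) j := by
  subst hi
  rw [inbox, ← net.nbr_injective _ (hj.trans (net.nbr_backPort v i).symm)]

lemma sum_traffic (net : Network n N) (ω : Fin n → ℕ → Bool) (T : ℕ) :
    ∑ v, A.traffic net ω T v = 2 * A.messagesBefore net ω T := by
  unfold traffic messagesBefore
  rw [Finset.sum_comm, Finset.mul_sum]
  refine Finset.sum_congr rfl fun t _ => ?_
  rw [Finset.sum_add_distrib, two_mul]
  congr 1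
  exact net.sum_nbr_backPort fun v i =>
    if (A.send (net.deg v) (A.run net ω t v) i).isSome then 1 else 0

lemma traffic_eq_zero {T : ℕ} {v : Fin n} :
    A.traffic net ω T v = 0 ↔ ∀ t < T, (∀ i, A.send (net.deg v) (A.run net ω t v) i = none) ∧
      ∀ i, A.inbox net ω t v i = none := by
  simp [traffic, sends]

lemma messagesBefore_mono (net : Network n N) (ω : Fin n → ℕ → Bool) :
    Monotone (A.messagesBefore net ω) :=
  fun _ _ h => Finset.sum_le_sum_of_subset (Finset.range_mono h)

lemma run_eq_silentRun {T : ℕ} {v : Fin n} (h : A.traffic net ω T v = 0) {t : ℕ} (ht : t ≤ T) :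
    A.run net ω t v = A.silentRun n (net.id v) (net.deg v) (ω v) t := by
  induction t with
  | zero => rfl
  | succ t ih =>
    rw [run_succ, ih (by omega), silentRun]
    exact congrArg _ <| funext (A.traffic_eq_zero.mp h t ht).2

lemma quiet_of_traffic_eq_zero {T : ℕ} {v : Fin n} (h : A.traffic net ω T v = 0) :
    A.Quiet n (net.id v) (net.deg v) T (ω v) := fun t ht i => by
  rw [← A.run_eq_silentRun h ht.le]
  exact (A.traffic_eq_zero.mp h t ht).1 i

end Run

/-! ### Measurability -/

lemma measurable_recv_comp {Ω : Type*} [MeasurableSpace Ω] {d : ℕ} {s : Ω → A.State}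
    {b : Ω → Fin d → Option Msg} (hs : Measurable s)
    (hb : ∀ i m, MeasurableSet {ω | b ω i = m}) : Measurable fun ω => A.recv d (s ω) (b ω) := by
  intro S hS
  have hunion : (fun ω => A.recv d (s ω) (b ω)) ⁻¹' S =
      ⋃ c : Fin d → Option Msg,
        (⋂ i, {ω | b ω i = c i}) ∩ s ⁻¹' ((fun x => A.recv d x c) ⁻¹' S) := by
    ext ω
    simp only [Set.mem_preimage, Set.mem_iUnion, Set.mem_inter_iff, Set.mem_iInter,
      Set.mem_ofPred_eq, ← funext_iff, exists_eq_left']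
  rw [hunion]
  exact .iUnion fun c => (MeasurableSet.iInter fun i => hb i _).inter
    (hs (A.measurable_recv d c hS))

lemma measurable_run (net : Network n N) (t : ℕ) (v : Fin n) :
    Measurable fun ω => A.run net ω t v := by
  induction t generalizing v with
  | zero => exact (A.measurable_init _ _ _).comp (measurable_pi_apply v)
  | succ t ih =>
    exact A.measurable_recv_comp (ih v) fun i m => (ih _) (A.measurable_send _ _ m)

lemma measurable_silentRun (n id d t : ℕ) : Measurable fun c => A.silentRun n id d c t := by
  induction t with
  | zero => exact A.measurable_init _ _ _
  | succ t ih => exact (A.measurable_recv d _).comp ih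

lemma measurable_isSome_send (d : ℕ) (i : Fin d) :
    Measurable fun s => if (A.send d s i).isSome then 1 else 0 := by
  refine Measurable.ite ?_ measurable_const measurable_const
  simp only [Option.isSome_iff_ne_none]
  exact (A.measurable_send d i none).compl

lemma measurable_sends (d : ℕ) : Measurable (A.sends d) :=
  Finset.measurable_sum _ fun i _ => A.measurable_isSome_send d i

lemma measurable_messagesBefore (net : Network n N) (T : ℕ) :
    Measurable fun ω => A.messagesBefore net ω T :=
  Finset.measurable_sum _ fun t _ => Finset.measurable_sum _ fun v _ =>
    (A.measurable_sends _).comp (A.measurable_run net t v)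

lemma measurable_traffic (net : Network n N) (T : ℕ) (v : Fin n) :
    Measurable fun ω => A.traffic net ω T v :=
  Finset.measurable_sum _ fun t _ =>
    ((A.measurable_sends _).comp (A.measurable_run net t v)).add <|
      Finset.measurable_sum _ fun i _ =>
        (A.measurable_isSome_send _ (net.backPort v i)).comp (A.measurable_run net t _)

lemma measurableSet_not_quiet (n id d T : ℕ) : MeasurableSet {c | ¬ A.Quiet n id d T c} := by
  simp only [Quiet, not_forall, Set.ofPred_exists]
  exact .iUnion fun t => .iUnion fun _ => .iUnion fun i =>
    ((A.measurable_silentRun n id d t) (A.measurable_send d i none)).compl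

lemma measurableSet_status_silentRun (n id d t : ℕ) (x : Status) :
    MeasurableSet {c | A.status (A.silentRun n id d c t) = x} :=
  (A.measurable_silentRun n id d t) (A.measurable_status x)

lemma measurableSet_status_run (net : Network n N) (t : ℕ) (v : Fin n) (x : Status) :
    MeasurableSet {ω | A.status (A.run net ω t v) = x} :=
  (A.measurable_run net t v) (A.measurable_status x)

lemma measurableSet_oneLeader (net : Network n N) (t : ℕ) :
    MeasurableSet {ω | A.OneLeader net ω t} := by
  simp only [OneLeader, Set.ofPred_exists, Set.ofPred_and, Set.ofPred_forall]
  exact .iUnion fun v => (A.measurableSet_status_run net t v _).inter <|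
    .iInter fun u => .iInter fun _ => A.measurableSet_status_run net t u _

end Algorithm

/-! ### Expectations -/

instance : IsProbabilityMeasure tapeMeasure := by
  unfold tapeMeasure; infer_instance

instance (n : ℕ) : IsProbabilityMeasure (coinMeasure n) := by
  unfold coinMeasure; infer_instance

lemma coinMeasure_real_eval {n : ℕ} (v : Fin n) {S : Set (ℕ → Bool)} (hS : MeasurableSet S) :
    (coinMeasure n).real {ω | ω v ∈ S} = tapeMeasure.real S :=
  (measurePreserving_eval (fun _ : Fin n => tapeMeasure) v).measureReal_preimage
    hS.nullMeasurableSet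

namespace Algorithm

variable {n N : ℕ} (A : Algorithm)

section Bounded

variable {net : Network n N} {b : ℝ}

lemma lintegral_messagesBefore_le (net : Network n N) (T : ℕ) :
    ∫⁻ ω, (A.messagesBefore net ω T : ℝ≥0∞) ∂coinMeasure n ≤ A.expectedMessages net := by
  refine lintegral_mono fun ω => ?_
  simp only [messagesBefore, Nat.cast_sum]
  exact ENNReal.sum_le_tsum _

lemma integrable_messagesBefore (h : A.expectedMessages net ≠ ∞) (T : ℕ) :
    Integrable (fun ω => (A.messagesBefore net ω T : ℝ)) (coinMeasure n) := by
  refine ⟨(measurable_from_top.comp (A.measurable_messagesBefore net T)).aestronglyMeasurable, ?_⟩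
  rw [hasFiniteIntegral_iff_enorm]
  simpa using (A.lintegral_messagesBefore_le net T).trans_lt h.lt_top

lemma integral_messagesBefore_le (hb : 0 ≤ b) (h : A.expectedMessages net ≤ ENNReal.ofReal b)
    (T : ℕ) : ∫ ω, (A.messagesBefore net ω T : ℝ) ∂coinMeasure n ≤ b := by
  rw [integral_eq_lintegral_of_nonneg_ae (.of_forall fun _ => by positivity)
    (A.integrable_messagesBefore (h.trans_lt ENNReal.ofReal_lt_top).ne T).aestronglyMeasurable]
  refine ENNReal.toReal_le_of_le_ofReal hb ?_
  simpa only [ENNReal.ofReal_natCast] using (A.lintegral_messagesBefore_le net T).trans h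

lemma sum_measureReal_traffic_ne_zero_le (hb : 0 ≤ b)
    (h : A.expectedMessages net ≤ ENNReal.ofReal b) (T : ℕ) :
    ∑ v, (coinMeasure n).real {ω | A.traffic net ω T v ≠ 0} ≤ 2 * b := by
  have hmeas : ∀ v, Measurable fun ω => (A.traffic net ω T v : ℝ≥0∞) := fun v =>
    measurable_from_top.comp (A.measurable_traffic net T v)
  have hmarkov : ∀ v, coinMeasure n {ω | A.traffic net ω T v ≠ 0} ≤
      ∫⁻ ω, (A.traffic net ω T v : ℝ≥0∞) ∂coinMeasure n := fun v => by
    simpa only [one_mul, Nat.one_le_cast, Nat.one_le_iff_ne_zero] using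
      mul_meas_ge_le_lintegral (μ := coinMeasure n) (hmeas v) 1
  have hsum : ∑ v, coinMeasure n {ω | A.traffic net ω T v ≠ 0} ≤ ENNReal.ofReal (2 * b) := calc
    _ ≤ ∑ v, ∫⁻ ω, (A.traffic net ω T v : ℝ≥0∞) ∂coinMeasure n :=
        Finset.sum_le_sum fun v _ => hmarkov v
    _ = ∫⁻ ω, 2 * (A.messagesBefore net ω T : ℝ≥0∞) ∂coinMeasure n := by
        rw [← lintegral_finsetSum _ fun v _ => hmeas v]
        exact lintegral_congr fun ω => mod_cast A.sum_traffic net ω T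
    _ = 2 * ∫⁻ ω, (A.messagesBefore net ω T : ℝ≥0∞) ∂coinMeasure n :=
        lintegral_const_mul' _ _ (by finiteness)
    _ ≤ 2 * ENNReal.ofReal b := by gcongr; exact (A.lintegral_messagesBefore_le net T).trans h
    _ = ENNReal.ofReal (2 * b) := by rw [ENNReal.ofReal_mul two_pos.le, ENNReal.ofReal_ofNat]
  simpa only [Measure.real, ← ENNReal.toReal_sum fun _ _ => measure_ne_top (coinMeasure n) _] using
    ENNReal.toReal_le_of_le_ofReal (by positivity) hsum

end Bounded

lemma sum_measureReal_elected_le (net : Network n N) (T : ℕ) :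
    ∑ v, (coinMeasure n).real {ω | A.status (A.run net ω T v) = .elected} ≤
      1 + n * (1 - (coinMeasure n).real {ω | A.OneLeader net ω T}) := by
  set L : Set (Fin n → ℕ → Bool) := {ω | A.OneLeader net ω T}
  set E : Fin n → Set (Fin n → ℕ → Bool) := fun v => {ω | A.status (A.run net ω T v) = .elected}
  have hL : MeasurableSet L := A.measurableSet_oneLeader net T
  have hE : ∀ v, MeasurableSet (E v) := fun v => A.measurableSet_status_run net T v _
  have hunique : Set.PairwiseDisjoint (Finset.univ : Finset (Fin n)) fun v => E v ∩ L := by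
    refine fun u _ v _ huv => Set.disjoint_left.mpr ?_
    rintro ω ⟨hu, w, -, hw⟩ ⟨hv, -⟩
    have heq : ∀ z, ω ∈ E z → z = w := fun z hz => by
      by_contra hzw
      exact Status.noConfusion (hz.symm.trans (hw z hzw))
    exact huv ((heq u hu).trans (heq v hv).symm)
  have hsplit : ∀ v, (coinMeasure n).real (E v) ≤
      (coinMeasure n).real (E v ∩ L) + (1 - (coinMeasure n).real L) := fun v => by
    rw [← probReal_compl_eq_one_sub hL, ← measureReal_inter_add_sdiff (s := E v) hL]
    exact add_le_add_right (measureReal_mono fun ω hω => hω.2) _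
  calc ∑ v, (coinMeasure n).real (E v)
      ≤ ∑ v, ((coinMeasure n).real (E v ∩ L) + (1 - (coinMeasure n).real L)) :=
        Finset.sum_le_sum fun v _ => hsplit v
    _ = ∑ v, (coinMeasure n).real (E v ∩ L) + n * (1 - (coinMeasure n).real L) := by
        simp only [Finset.sum_add_distrib, Finset.sum_const, Finset.card_univ, Fintype.card_fin,
          nsmul_eq_mul]
    _ ≤ 1 + n * (1 - (coinMeasure n).real L) := by
        gcongr
        exact (sum_measureReal_le_measureReal_univ (fun v _ => (hE v).inter hL) hunique).trans_eq
          probReal_univ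

section Silent

variable (net : Network n N) (T : ℕ) (v : Fin n)

lemma measureReal_not_quiet_le :
    tapeMeasure.real {c | ¬ A.Quiet n (net.id v) (net.deg v) T c} ≤
      (coinMeasure n).real {ω | A.traffic net ω T v ≠ 0} := by
  rw [← coinMeasure_real_eval v (A.measurableSet_not_quiet _ _ _ T)]
  exact measureReal_mono fun ω hω h => hω (A.quiet_of_traffic_eq_zero h)

lemma measureReal_silentRun_elected_le :
    tapeMeasure.real {c | A.status (A.silentRun n (net.id v) (net.deg v) c T) = .elected} ≤
      (coinMeasure n).real {ω | A.status (A.run net ω T v) = .elected} +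
        (coinMeasure n).real {ω | A.traffic net ω T v ≠ 0} := by
  rw [← coinMeasure_real_eval v (A.measurableSet_status_silentRun _ _ _ T _)]
  refine (measureReal_mono fun ω hω => ?_).trans (measureReal_union_le _ _)
  by_cases h : A.traffic net ω T v = 0
  · exact .inl ((congrArg A.status (A.run_eq_silentRun h le_rfl)).trans hω)
  · exact .inr h

end Silent

lemma exists_quiet_node {net : Network n N} {b δ η : ℝ} {T : ℕ} (hb : 0 ≤ b) (hη : 0 < η)
    (h : A.expectedMessages net ≤ ENNReal.ofReal b)
    (hT : 1 / 2 + δ ≤ (coinMeasure n).real {ω | A.OneLeader net ω T})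
    (hn : 1 + 2 * b * (1 + 1 / (2 * η)) < δ * n) :
    ∃ v, tapeMeasure.real
        {c | A.status (A.silentRun n (net.id v) (net.deg v) c T) = .elected} ≤ 1 / 2 ∧
      tapeMeasure.real {c | ¬ A.Quiet n (net.id v) (net.deg v) T c} ≤ η := by
  set p : Fin n → ℝ := fun v => (coinMeasure n).real {ω | A.traffic net ω T v ≠ 0}
  set q : Fin n → ℝ := fun v => (coinMeasure n).real {ω | A.status (A.run net ω T v) = .elected}
  have hsum : ∑ v, (q v + p v * (1 + 1 / (2 * η))) < ∑ _v : Fin n, (1 / 2 : ℝ) := calc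
    _ = ∑ v, q v + (∑ v, p v) * (1 + 1 / (2 * η)) := by
        rw [Finset.sum_add_distrib, Finset.sum_mul]
    _ ≤ (1 + n * (1 - (1 / 2 + δ))) + 2 * b * (1 + 1 / (2 * η)) := by
        gcongr
        · exact (A.sum_measureReal_elected_le net T).trans (by gcongr)
        · exact A.sum_measureReal_traffic_ne_zero_le hb h T
    _ < n * (1 / 2) := by linarith
    _ = _ := by simp
  obtain ⟨v, -, hv⟩ := Finset.exists_lt_of_sum_lt hsum
  have hp : 0 ≤ p v := measureReal_nonneg
  have hq : 0 ≤ q v := measureReal_nonneg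
  have hpη : p v * (1 / (2 * η)) ≤ 1 / 2 := by linarith
  refine ⟨v, (A.measureReal_silentRun_elected_le net T v).trans ?_,
    (A.measureReal_not_quiet_le net T v).trans ?_⟩
  · have : 0 ≤ p v * (1 / (2 * η)) := by positivity
    linarith
  · rwa [mul_one_div, div_le_iff₀ (by positivity), one_div_mul_eq_div,
      mul_div_cancel_left₀ _ two_ne_zero] at hpη

lemma eventually_oneLeader {net : Network n N} {a : ℝ} (h : a < A.successProb net) :
    ∀ᶠ T in Filter.atTop, a ≤ (coinMeasure n).real {ω | A.OneLeader net ω T} := by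
  have hunion : {ω | A.Solves net ω} = ⋃ T, {ω | ∀ t, T ≤ t → A.OneLeader net ω t} := by
    ext ω
    simp [Solves]
  have hmono : Monotone fun T => {ω | ∀ t, T ≤ t → A.OneLeader net ω t} :=
    fun T T' hT ω hω t ht => hω t (hT.trans ht)
  have hlim := (ENNReal.tendsto_toReal (measure_ne_top _ _)).comp
    (tendsto_measure_iUnion_atTop (μ := coinMeasure n) hmono)
  rw [← hunion] at hlim
  filter_upwards [hlim.eventually_const_lt h] with T hT
  exact hT.le.trans (measureReal_mono fun ω hω => hω T le_rfl)

lemma exists_round_oneLeader {P : Network n N → Prop} {a b : ℝ} (hab : a < b)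
    (h : ∀ net, P net → b ≤ A.successProb net) :
    ∃ T, ∀ net, P net → a ≤ (coinMeasure n).real {ω | A.OneLeader net ω T} :=
  (Filter.eventually_all.mpr fun net => Filter.eventually_imp_distrib_left.mpr fun hnet =>
    A.eventually_oneLeader (hab.trans_le (h net hnet))).exists

end Algorithm

/-! ### Networks on an arbitrary type of nodes -/

/-- A port-numbered simple graph on the nodes `V`, given by the neighbour behind every port. It
serves to build a `Network` without choosing neighbour sets or numbering the nodes. -/
structure Wiring (V : Type*) where
  deg : V → ℕ
  nbr : (v : V) → Fin (deg v) → V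
  nbr_injective : ∀ v, Function.Injective (nbr v)
  nbr_ne : ∀ v i, nbr v i ≠ v
  exists_nbr_nbr : ∀ v i, ∃ j, nbr (nbr v i) j = v

namespace Wiring

variable {V : Type*} {n N : ℕ} (W : Wiring V) (e : V ≃ Fin n) (ids : V ↪ Set.Icc 1 N)

/-- The underlying simple graph of a wiring. -/
def graph : SimpleGraph V where
  Adj v w := ∃ i, W.nbr v i = w
  symm := ⟨by rintro v _ ⟨i, rfl⟩; exact W.exists_nbr_nbr v i⟩
  loopless := ⟨fun v ⟨i, hi⟩ => W.nbr_ne v i hi⟩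

/-- The network with wiring `W` and IDs `ids`, its nodes being numbered by `e`. -/
noncomputable def toNetwork : Network n N where
  graph := W.graph.comap e.symm
  deg a := W.deg (e.symm a)
  port a := .ofBijective
    (fun i => ⟨e (W.nbr (e.symm a) i), i, (e.symm_apply_apply _).symm⟩)
    ⟨fun _ _ h => W.nbr_injective _ (e.injective (congrArg Subtype.val h)),
      fun ⟨_, i, hi⟩ => ⟨i, Subtype.ext (e.symm_apply_eq.mp hi.symm).symm⟩⟩
  id a := ids (e.symm a)
  id_injective := Subtype.val_injective.comp (ids.injective.comp e.symm.injective)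
  id_mem a := (ids (e.symm a)).2

lemma ediam_toNetwork_le_two {c : V} (hc : ∀ v, v ≠ c → ∃ i, W.nbr c i = v) :
    (W.toNetwork e ids).graph.ediam ≤ 2 := by
  have hdist : ∀ a, (W.toNetwork e ids).graph.edist (e c) a ≤ 1 := fun a => by
    by_cases ha : a = e c
    · simp [ha]
    · have hadj : (W.toNetwork e ids).graph.Adj (e c) a := by
        change W.graph.Adj (e.symm (e c)) (e.symm a)
        rw [e.symm_apply_apply]
        exact hc _ fun h => ha (e.symm_apply_eq.mp h)
      simpa using SimpleGraph.edist_le hadj.toWalk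
  calc (W.toNetwork e ids).graph.ediam ≤ 2 * (W.toNetwork e ids).graph.radius :=
        SimpleGraph.ediam_le_two_mul_radius
    _ ≤ 2 * 1 := by
        gcongr
        exact SimpleGraph.radius_le_eccent.trans (iSup_le hdist)

variable (A : Algorithm) (ω : Fin n → ℕ → Bool)

lemma run_toNetwork_zero (v : V) :
    A.run (W.toNetwork e ids) ω 0 (e v) = A.init n (ids v) (W.deg v) (ω (e v)) := by
  simp only [Algorithm.run, toNetwork, e.symm_apply_apply]

lemma run_toNetwork_succ {t : ℕ} {v : V} {b : Fin (W.deg v) → Option Msg}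
    (hb : ∀ w i j, W.nbr v i = w → W.nbr w j = v →
      b i = A.send (W.deg w) (A.run (W.toNetwork e ids) ω t (e w)) j) :
    A.run (W.toNetwork e ids) ω (t + 1) (e v) =
      A.recv (W.deg v) (A.run (W.toNetwork e ids) ω t (e v)) b := by
  obtain ⟨a, rfl⟩ := e.symm.surjective v
  rw [e.apply_symm_apply]
  refine congrArg (A.recv _ _) <| funext fun (i : Fin (W.deg (e.symm a))) => ?_
  obtain ⟨c, hc⟩ := e.symm.surjective (W.nbr (e.symm a) i)
  obtain ⟨j, hj⟩ : ∃ j, W.nbr (e.symm c) j = e.symm a := hc ▸ W.exists_nbr_nbr _ i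
  rw [hb _ i j hc.symm hj, e.apply_symm_apply]
  have hac : (W.toNetwork e ids).nbr a i = c := (e.symm_apply_eq.mp hc).symm
  have hca : (W.toNetwork e ids).nbr c j = a := (e.symm_apply_eq.mp hj.symm).symm
  exact A.inbox_eq_send hac hca t

lemma messagesInRound_toNetwork [Fintype V] (t : ℕ) :
    A.messagesInRound (W.toNetwork e ids) ω t =
      ∑ v, A.sends (W.deg v) (A.run (W.toNetwork e ids) ω t (e v)) := by
  rw [← e.symm.sum_comp]
  simp only [e.apply_symm_apply]
  rfl

end Wiring

/-! ### Cliques and twin cliques -/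

/-- The wiring of the complete graph. -/
def cliqueWiring (M : ℕ) : Wiring (Fin (M + 1)) where
  deg _ := M
  nbr := Fin.succAbove
  nbr_injective _ := Fin.succAbove_right_injective
  nbr_ne := Fin.succAbove_ne
  exists_nbr_nbr v i := Fin.exists_succAbove_eq (v.succAbove_ne i).symm

/-- The complete network with IDs `ids`. -/
noncomputable def clique {M N : ℕ} (ids : Fin (M + 1) ↪ Set.Icc 1 N) : Network (M + 1) N :=
  (cliqueWiring M).toNetwork (.refl _) ids

lemma ediam_clique_le_two {M N : ℕ} (ids : Fin (M + 1) ↪ Set.Icc 1 N) :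
    (clique ids).graph.ediam ≤ 2 :=
  (cliqueWiring M).ediam_toNetwork_le_two _ ids (c := 0) fun _ => Fin.exists_succAbove_eq

/-- The nodes of a pair of twin cliques, that is of two cliques of `m + k + 1` nodes each with
`k + 1` nodes in common: the hubs, which belong to both cliques, and `m` private nodes on either
side. -/
abbrev TwinNode (m k : ℕ) : Type := Fin (k + 1) ⊕ Bool × Fin m

/-- The identification of one of the twin cliques with a clique on `Fin (m + k + 1)`. It tells which
nodes of the latter the hubs take the places of, and what the ports of the private nodes are. -/
abbrev Placement (m k : ℕ) : Type := Fin (k + 1) ⊕ Fin m ≃ Fin (m + k + 1)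

section Twin

variable {m k N : ℕ}

instance : Nonempty (Placement m k) := ⟨Fintype.equivOfCardEq (by simp; omega)⟩

/-- A fixed enumeration of the nodes of a pair of twin cliques. -/
noncomputable def twinEnum (m k : ℕ) : TwinNode m k ≃ Fin (2 * m + k + 1) :=
  Fintype.equivFinOfCardEq (by simp; omega)

/-- The node of the twin cliques at position `u` of the clique on side `s`. -/
def twinAt (x : Bool → Placement m k) (s : Bool) (u : Fin (m + k + 1)) : TwinNode m k :=
  Sum.map id (Prod.mk s) ((x s).symm u)

lemma twinAt_injective (x : Bool → Placement m k) (s : Bool) :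
    Function.Injective (twinAt x s) :=
  (Function.injective_id.sumMap (Prod.mk_right_injective s)).comp (x s).symm.injective

@[simp]
lemma twinAt_apply (x : Bool → Placement m k) (s : Bool) (y : Fin (k + 1) ⊕ Fin m) :
    twinAt x s (x s y) = Sum.map id (Prod.mk s) y := by
  simp [twinAt]

/-- The number of neighbours of a node of the twin cliques. -/
def twinDeg : TwinNode m k → ℕ
  | .inl _ => 2 * m + k
  | .inr _ => m + k

/-- The neighbours of a node of the twin cliques, by port. -/
noncomputable def twinNbr (x : Bool → Placement m k) :
    (v : TwinNode m k) → Fin (twinDeg v) → TwinNode m k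
  | .inl j, i => (twinEnum m k).symm ((twinEnum m k (.inl j)).succAbove i)
  | .inr (s, a), i => twinAt x s ((x s (.inr a)).succAbove i)

lemma exists_twinNbr_inl (x : Bool → Placement m k) {j : Fin (k + 1)} {v : TwinNode m k}
    (hv : v ≠ .inl j) : ∃ i, twinNbr x (.inl j) i = v := by
  obtain ⟨i, hi⟩ := Fin.exists_succAbove_eq ((twinEnum m k).injective.ne hv)
  exact ⟨i, (twinEnum m k).symm_apply_eq.mpr hi⟩

lemma exists_twinNbr_inr (x : Bool → Placement m k) {s : Bool} {a : Fin m}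
    {y : Fin (k + 1) ⊕ Fin m} (hy : y ≠ .inr a) :
    ∃ i, twinNbr x (.inr (s, a)) i = Sum.map id (Prod.mk s) y := by
  obtain ⟨i, hi⟩ := Fin.exists_succAbove_eq ((x s).injective.ne hy)
  exact ⟨i, (congrArg (twinAt x s) hi).trans (twinAt_apply x s y)⟩

/-- The wiring of the twin cliques: a port of a private node leads to the place to which it leads in
the clique on its side, whereas the ports of the hubs follow the enumeration of all nodes. -/
noncomputable def twinWiring (x : Bool → Placement m k) : Wiring (TwinNode m k) where
  deg := twinDeg
  nbr := twinNbr x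
  nbr_injective
    | .inl _ => (twinEnum m k).symm.injective.comp Fin.succAbove_right_injective
    | .inr (s, _) => (twinAt_injective x s).comp Fin.succAbove_right_injective
  nbr_ne
    | .inl j, i => fun h => Fin.succAbove_ne _ i ((twinEnum m k).symm_apply_eq.mp h)
    | .inr (s, a), i => fun h => Fin.succAbove_ne _ i <|
        twinAt_injective x s (h.trans (twinAt_apply x s (.inr a)).symm)
  exists_nbr_nbr := by
    rintro (j | ⟨s, a⟩) i
    · have hne : twinNbr x (.inl j) i ≠ .inl j := fun h =>
        Fin.succAbove_ne _ i ((twinEnum m k).symm_apply_eq.mp h)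
      rcases hw : twinNbr x (.inl j) i with j' | ⟨s, a⟩
      · exact exists_twinNbr_inl x (hw ▸ hne).symm
      · exact exists_twinNbr_inr x (y := .inl j) Sum.inl_ne_inr
    · obtain ⟨y, hy⟩ := (x s).surjective ((x s (.inr a)).succAbove i)
      have hw : twinNbr x (.inr (s, a)) i = Sum.map id (Prod.mk s) y :=
        (congrArg (twinAt x s) hy.symm).trans (twinAt_apply x s y)
      rw [hw]
      rcases y with j | b
      · exact exists_twinNbr_inl x Sum.inr_ne_inl
      · refine exists_twinNbr_inr x (y := .inr a) fun hab => ?_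
        exact Fin.succAbove_ne _ i (hy.symm.trans (congrArg (x s) hab.symm))

end Twin

/-- The nodes of two disjoint cliques of size `m + k + 1`, together with `k + 1` hubs. The IDs and
the coin flips of the nodes of the twin cliques, for all placements, are taken from these. -/
abbrev Source (m k : ℕ) : Type := Bool × Fin (m + k + 1) ⊕ Fin (k + 1)

/-- The coin flips of the nodes of two disjoint cliques and of the hubs. -/
abbrev SourceCoins (m k : ℕ) : Type :=
  (Bool → Fin (m + k + 1) → ℕ → Bool) × (Fin (k + 1) → ℕ → Bool)

section Twin

variable {m k N : ℕ}

/-- The node from which a node of the twin cliques takes its ID and its coin flips. -/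
def origin (x : Bool → Placement m k) : TwinNode m k → Source m k
  | .inl j => .inr j
  | .inr (s, a) => .inl (s, x s (.inr a))

lemma origin_injective (x : Bool → Placement m k) : Function.Injective (origin x) := by
  rintro (j | ⟨s, a⟩) (j' | ⟨s', a'⟩) h <;>
    simp only [origin, Sum.inl.injEq, Sum.inr.injEq, Prod.mk.injEq, reduceCtorEq] at h
  · rw [h]
  · obtain ⟨rfl, h⟩ := h
    rw [Sum.inr_injective ((x s).injective h)]

/-- The clique on side `s`. -/
noncomputable def sideClique (ids : Source m k ↪ Set.Icc 1 N) (s : Bool) :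
    Network (m + k + 1) N :=
  clique ⟨fun u => ids (.inl (s, u)),
    ids.injective.comp (Sum.inl_injective.comp (Prod.mk_right_injective s))⟩

/-- The network formed by the twin cliques. -/
noncomputable def twinCliques (ids : Source m k ↪ Set.Icc 1 N) (x : Bool → Placement m k) :
    Network (2 * m + k + 1) N :=
  (twinWiring x).toNetwork (twinEnum m k) ⟨fun v => ids (origin x v),
    ids.injective.comp (origin_injective x)⟩

lemma ediam_twinCliques_le_two (ids : Source m k ↪ Set.Icc 1 N) (x : Bool → Placement m k) :
    (twinCliques ids x).graph.ediam ≤ 2 :=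
  (twinWiring x).ediam_toNetwork_le_two _ _ (c := .inl 0) fun _ => exists_twinNbr_inl x

lemma twinNbr_inr_eq_iff {x : Bool → Placement m k} {s : Bool} {a : Fin m} {i : Fin (m + k)}
    {y : Fin (k + 1) ⊕ Fin m} : twinNbr x (.inr (s, a)) i = Sum.map id (Prod.mk s) y ↔
      (x s (.inr a)).succAbove i = x s y := by
  rw [← twinAt_apply x s y]
  exact (twinAt_injective x s).eq_iff

/-- The coin flips of the nodes of the twin cliques. -/
noncomputable def twinCoins (x : Bool → Placement m k) (ω : SourceCoins m k) :
    Fin (2 * m + k + 1) → ℕ → Bool :=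
  fun v => Sum.elim (Function.uncurry ω.1) ω.2 (origin x ((twinEnum m k).symm v))

namespace Algorithm

variable (A : Algorithm) (ids : Source m k ↪ Set.Icc 1 N)

/-- No hub sends a message in the first `T` rounds unless it receives one. -/
def HubsQuiet (T : ℕ) (ω : SourceCoins m k) : Prop :=
  ∀ j, A.Quiet (2 * m + k + 1) (ids (.inr j)) (2 * m + k) T (ω.2 j)

/-- The number of messages that the two disjoint cliques send in the first `T` rounds. -/
noncomputable def sideMessages (ω : SourceCoins m k) (T : ℕ) : ℕ :=
  ∑ s, (A.withSize (2 * m + k + 1)).messagesBefore (sideClique ids s) (ω.1 s) T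

variable (x : Bool → Placement m k)

/-- The number of messages that, in the disjoint cliques, the nodes whose places the hubs take send
or receive in the first `T` rounds. -/
noncomputable def hubTraffic (ω : SourceCoins m k) (T : ℕ) : ℕ :=
  ∑ s, ∑ j, (A.withSize (2 * m + k + 1)).traffic (sideClique ids s) (ω.1 s) T (x s (.inl j))

/-- The local states of the nodes of the twin cliques after `t` rounds, as long as no message
crosses a hub: the private nodes behave as in the disjoint cliques, the hubs hear nothing. -/
noncomputable def uncrossedRun (ω : SourceCoins m k) (t : ℕ) : TwinNode m k → A.State
  | .inl j => A.silentRun (2 * m + k + 1) (ids (.inr j)) (2 * m + k) (ω.2 j) t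
  | .inr (s, a) =>
    (A.withSize (2 * m + k + 1)).run (sideClique ids s) (ω.1 s) t (x s (.inr a))

variable {A ids x} {ω : SourceCoins m k} {t T : ℕ}

lemma hubTraffic_eq_zero : A.hubTraffic ids x ω T = 0 ↔
    ∀ s j, (A.withSize (2 * m + k + 1)).traffic (sideClique ids s) (ω.1 s) T
      (x s (.inl j)) = 0 := by
  simp only [hubTraffic, Finset.sum_eq_zero_iff, Finset.mem_univ, true_imp_iff]

lemma HubsQuiet.anti {τ : ℕ} (hq : A.HubsQuiet ids T ω) (hτ : τ ≤ T) : A.HubsQuiet ids τ ω :=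
  fun j t ht => hq j t (ht.trans_le hτ)

lemma send_uncrossedRun_inl (hq : A.HubsQuiet ids T ω) (ht : t < T) (j : Fin (k + 1))
    (i : Fin (2 * m + k)) : A.send (2 * m + k) (A.uncrossedRun ids x ω t (.inl j)) i = none :=
  hq j t ht i

lemma send_uncrossedRun_of_nbr_inl (hx : A.hubTraffic ids x ω T = 0) (ht : t < T) {s : Bool}
    {a : Fin m} {i : Fin (m + k)} {j : Fin (k + 1)} (h : twinNbr x (.inr (s, a)) i = .inl j) :
    A.send (m + k) (A.uncrossedRun ids x ω t (.inr (s, a))) i = none := by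
  have hi := (twinNbr_inr_eq_iff (y := .inl j)).mp h
  obtain ⟨i', hi'⟩ :=
    Fin.exists_succAbove_eq ((x s).injective.ne (Sum.inr_ne_inl (a := j) (b := a)))
  exact ((A.withSize _).inbox_eq_send (net := sideClique ids s) hi' hi t).symm.trans
    (((A.withSize _).traffic_eq_zero.mp (hubTraffic_eq_zero.mp hx s j) t ht).2 i')

lemma inbox_sideClique_eq (hq : A.HubsQuiet ids T ω) (hx : A.hubTraffic ids x ω T = 0) (ht : t < T)
    {s : Bool} {a : Fin m} {v : TwinNode m k} {i : Fin (m + k)} {j : Fin (twinDeg v)}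
    (hi : twinNbr x (.inr (s, a)) i = v) (hj : twinNbr x v j = .inr (s, a)) :
    (A.withSize (2 * m + k + 1)).inbox (sideClique ids s) (ω.1 s) t (x s (.inr a)) i =
      A.send (twinDeg v) (A.uncrossedRun ids x ω t v) j := by
  obtain ⟨y, rfl⟩ : ∃ y, Sum.map id (Prod.mk s) y = v := ⟨_, hi⟩
  have hi' := twinNbr_inr_eq_iff.mp hi
  rcases y with j' | b
  · obtain ⟨l, hl⟩ := Fin.exists_succAbove_eq ((x s).injective.ne (Sum.inr_ne_inl (a := j')))
    refine ((A.withSize _).inbox_eq_send (net := sideClique ids s) hi' hl t).trans ?_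
    refine Eq.trans ?_ (send_uncrossedRun_inl hq ht j' j).symm
    exact ((A.withSize _).traffic_eq_zero.mp (hubTraffic_eq_zero.mp hx s j') t ht).1 l
  · exact (A.withSize _).inbox_eq_send (net := sideClique ids s) hi'
      ((twinNbr_inr_eq_iff (y := .inr a)).mp hj) t

lemma run_twinCliques (hq : A.HubsQuiet ids T ω) (hx : A.hubTraffic ids x ω T = 0) (ht : t ≤ T)
    (v : TwinNode m k) :
    A.run (twinCliques ids x) (twinCoins x ω) t (twinEnum m k v) = A.uncrossedRun ids x ω t v := by
  induction t generalizing v with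
  | zero =>
    refine ((twinWiring x).run_toNetwork_zero _ _ A _ v).trans ?_
    rcases v with j | ⟨s, a⟩ <;> simp only [twinCoins, Equiv.symm_apply_apply] <;> rfl
  | succ t ih =>
    have hrun := fun v => ih (by omega) v
    rcases v with j | ⟨s, a⟩
    · refine ((twinWiring x).run_toNetwork_succ _ _ A _ (b := fun _ => none) ?_).trans
        (congrArg (fun r => A.recv (2 * m + k) r fun _ => none) (hrun (.inl j)))
      rintro (j' | ⟨s, a⟩) i i' - hi'
      · exact ((congrArg (A.send _ · i') (hrun _)).trans (send_uncrossedRun_inl hq ht j' i')).symm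
      · exact ((congrArg (A.send _ · i') (hrun _)).trans
          (send_uncrossedRun_of_nbr_inl hx ht hi')).symm
    · refine ((twinWiring x).run_toNetwork_succ _ _ A _ ?_).trans
        (congrArg (fun r => A.recv (m + k) r <| (A.withSize (2 * m + k + 1)).inbox
          (sideClique ids s) (ω.1 s) t (x s (.inr a))) (hrun (.inr (s, a))))
      rintro w i i' hi hi'
      exact (inbox_sideClique_eq hq hx ht hi hi').trans (congrArg (A.send _ · i') (hrun _)).symm

end Algorithm

end Twin

namespace Algorithm

section Messages

variable {m k N : ℕ} {A : Algorithm} {ids : Source m k ↪ Set.Icc 1 N} {ω : SourceCoins m k}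
  {x : Bool → Placement m k} {t T : ℕ}

lemma sum_messagesInRound_sideClique_le (hq : A.HubsQuiet ids T ω)
    (hx : A.hubTraffic ids x ω T = 0) (ht : t ≤ T) :
    ∑ s, (A.withSize (2 * m + k + 1)).messagesInRound (sideClique ids s) (ω.1 s) t ≤
      A.messagesInRound (twinCliques ids x) (twinCoins x ω) t + ∑ s, ∑ j, A.sends (m + k)
        ((A.withSize (2 * m + k + 1)).run (sideClique ids s) (ω.1 s) t (x s (.inl j))) := by
  have hside : ∀ s, (A.withSize (2 * m + k + 1)).messagesInRound (sideClique ids s) (ω.1 s) t =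
      ∑ j, A.sends (m + k)
          ((A.withSize (2 * m + k + 1)).run (sideClique ids s) (ω.1 s) t (x s (.inl j))) +
        ∑ a, A.sends (m + k) (A.uncrossedRun ids x ω t (.inr (s, a))) := fun s =>
    ((x s).sum_comp fun u => A.sends (m + k)
      ((A.withSize (2 * m + k + 1)).run (sideClique ids s) (ω.1 s) t u)).symm.trans
      (Fintype.sum_sum_type _)
  have htwin : A.messagesInRound (twinCliques ids x) (twinCoins x ω) t =
      ∑ v, A.sends (twinDeg v) (A.uncrossedRun ids x ω t v) :=
    ((twinWiring x).messagesInRound_toNetwork _ _ A _ t).trans <|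
      Finset.sum_congr rfl fun v _ => congrArg (A.sends (twinDeg v)) (run_twinCliques hq hx ht v)
  rw [htwin, Fintype.sum_sum_type, Fintype.sum_prod_type]
  simp only [hside, Finset.sum_add_distrib, twinDeg]
  omega

lemma sideMessages_le_of_hubTraffic_eq_zero (hq : A.HubsQuiet ids t ω)
    (hx : A.hubTraffic ids x ω t = 0) :
    A.sideMessages ids ω (t + 1) ≤
      A.messagesBefore (twinCliques ids x) (twinCoins x ω) (t + 1) +
        A.hubTraffic ids x ω (t + 1) := by
  have hhub : ∑ i ∈ Finset.range (t + 1), ∑ s, ∑ j, A.sends (m + k)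
        ((A.withSize (2 * m + k + 1)).run (sideClique ids s) (ω.1 s) i (x s (.inl j))) ≤
      A.hubTraffic ids x ω (t + 1) := by
    rw [Finset.sum_comm]
    refine Finset.sum_le_sum fun s _ => ?_
    rw [Finset.sum_comm]
    exact Finset.sum_le_sum fun j _ => Finset.sum_le_sum fun i _ => Nat.le_add_right _ _
  calc A.sideMessages ids ω (t + 1)
      = ∑ i ∈ Finset.range (t + 1), ∑ s,
          (A.withSize (2 * m + k + 1)).messagesInRound (sideClique ids s) (ω.1 s) i :=
        Finset.sum_comm
    _ ≤ _ := (Finset.sum_le_sum fun i hi =>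
        sum_messagesInRound_sideClique_le hq hx (Finset.mem_range_succ_iff.mp hi)).trans_eq
          Finset.sum_add_distrib
    _ ≤ _ := Nat.add_le_add_left hhub _

-- If the hub traffic is already nonzero after `t` rounds, then the last summand alone suffices.
-- Only its second factor depends on the placement, so that its average can be computed.
lemma sideMessages_le (hq : A.HubsQuiet ids T ω) (ht : t + 1 ≤ T) (x : Bool → Placement m k) :
    A.sideMessages ids ω (t + 1) ≤
      A.messagesBefore (twinCliques ids x) (twinCoins x ω) T + A.hubTraffic ids x ω (t + 1) +
        A.sideMessages ids ω (t + 1) * A.hubTraffic ids x ω t := by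
  by_cases hx : A.hubTraffic ids x ω t = 0
  · calc A.sideMessages ids ω (t + 1) ≤ _ :=
          sideMessages_le_of_hubTraffic_eq_zero (hq.anti (by omega)) hx
      _ ≤ _ := Nat.add_le_add_right (messagesBefore_mono _ _ _ ht) _
      _ ≤ _ := Nat.le_add_right _ _
  · exact (Nat.le_mul_of_pos_right _ (Nat.pos_of_ne_zero hx)).trans (Nat.le_add_left _ _)

open Finset in
lemma expect_hubTraffic (A : Algorithm) (ids : Source m k ↪ Set.Icc 1 N) (ω : SourceCoins m k)
    (T : ℕ) : 𝔼 x : Bool → Placement m k, (A.hubTraffic ids x ω T : ℝ) =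
      2 * (k + 1) / (m + k + 1) * A.sideMessages ids ω T := by
  have hplace : ∀ s j, 𝔼 x : Bool → Placement m k,
      ((A.withSize (2 * m + k + 1)).traffic (sideClique ids s) (ω.1 s) T (x s (.inl j)) : ℝ) =
        2 * (A.withSize (2 * m + k + 1)).messagesBefore (sideClique ids s) (ω.1 s) T /
          (m + k + 1) := fun s j => by
    rw [expect_eval (fun p : Placement m k => ((A.withSize (2 * m + k + 1)).traffic
      (sideClique ids s) (ω.1 s) T (p (.inl j)) : ℝ)),
      expect_equiv_apply (fun u => ((A.withSize (2 * m + k + 1)).traffic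
        (sideClique ids s) (ω.1 s) T u : ℝ)), Fintype.expect_eq_sum_div_card, ← Nat.cast_sum,
      sum_traffic, Fintype.card_fin]
    push_cast
    rfl
  simp only [hubTraffic, sideMessages, Nat.cast_sum, expect_sum_comm, hplace, sum_const, card_univ,
    Fintype.card_fin, nsmul_eq_mul, mul_sum]
  refine sum_congr rfl fun s _ => ?_
  push_cast
  ring

lemma half_le_expect_messagesBefore {κ : ℝ} (hκ : 0 < κ)
    (hsmall : 2 * (k + 1) / (m + k + 1) * (1 + κ) ≤ (1 / 2 : ℝ)) (hq : A.HubsQuiet ids T ω)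
    (h : κ ≤ A.sideMessages ids ω T) :
    κ / 2 ≤ 𝔼 x, (A.messagesBefore (twinCliques ids x) (twinCoins x ω) T : ℝ) := by
  classical
  have hex : ∃ t, κ ≤ A.sideMessages ids ω t := ⟨T, h⟩
  -- Stop in the round `t + 1` in which the cliques reach `κ` messages. The run of the cliques does
  -- not depend on the placement, so most placements have no hub traffic in the `t` rounds before.
  obtain ⟨t, htfind⟩ : ∃ t, Nat.find hex = t + 1 := by
    refine Nat.exists_eq_succ_of_ne_zero fun h0 => hκ.not_ge ?_
    simpa [sideMessages, messagesBefore] using (Nat.find_eq_zero hex).mp h0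
  have hlt : A.sideMessages ids ω t < κ := not_le.mp (Nat.find_min hex (by omega))
  have hge : κ ≤ A.sideMessages ids ω (t + 1) := htfind ▸ Nat.find_spec hex
  have htT : t + 1 ≤ T := htfind ▸ Nat.find_min' hex h
  set H := (A.sideMessages ids ω (t + 1) : ℝ) with hH
  set θ : ℝ := 2 * (k + 1) / (m + k + 1) with hθ
  have havg : H ≤ 𝔼 x, (A.messagesBefore (twinCliques ids x) (twinCoins x ω) T : ℝ) + θ * H +
      H * (θ * A.sideMessages ids ω t) := by
    rw [hH, hθ, ← expect_hubTraffic A ids ω (t + 1), ← expect_hubTraffic A ids ω t,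
      Finset.mul_expect, ← Finset.expect_add_distrib, ← Finset.expect_add_distrib]
    exact Finset.le_expect Finset.univ_nonempty fun x _ => mod_cast sideMessages_le hq htT x
  have : 0 ≤ θ := by positivity
  have herror : θ * H + H * (θ * A.sideMessages ids ω t) ≤ H / 2 := by
    calc θ * H + H * (θ * A.sideMessages ids ω t) = H * (θ * (1 + A.sideMessages ids ω t)) := by
          ring
      _ ≤ H * (θ * (1 + κ)) := by gcongr
      _ ≤ H * (1 / 2) := by gcongr
      _ = H / 2 := by ring
  linarith

end Messages

end Algorithm

/-! ### Signs -/

open Classical in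
/-- The sign of an elected node is `-1` and that of every other node is `1`, so that the product of
the signs of all nodes is `-1` if exactly one of them is elected. -/
noncomputable def leaderSign (x : Status) : ℝ := if x = .elected then -1 else 1

lemma abs_leaderSign (x : Status) : |leaderSign x| = 1 := by
  unfold leaderSign
  split_ifs <;> simp

/-- The law of the coin flips of two disjoint cliques and of the hubs. -/
noncomputable def sourceMeasure (m k : ℕ) : Measure (SourceCoins m k) :=
  (Measure.pi fun _ : Bool => coinMeasure (m + k + 1)).prod (coinMeasure (k + 1))

instance (m k : ℕ) : IsProbabilityMeasure (sourceMeasure m k) := by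
  unfold sourceMeasure
  infer_instance

lemma measurePreserving_twinCoins {m k : ℕ} (x : Bool → Placement m k) :
    MeasurePreserving (twinCoins x) (sourceMeasure m k) (coinMeasure (2 * m + k + 1)) :=
  (measurePreserving_precomp tapeMeasure
    ((origin_injective x).comp (twinEnum m k).symm.injective)).comp
      (measurePreserving_sumElim_uncurry tapeMeasure)

namespace Algorithm

variable (A : Algorithm)

lemma measurable_leaderSign : Measurable fun s => leaderSign (A.status s) :=
  .ite (A.measurable_status .elected) measurable_const measurable_const

lemma prod_leaderSign_of_oneLeader {A : Algorithm} {n N T : ℕ} {net : Network n N}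
    {ω : Fin n → ℕ → Bool} (h : A.OneLeader net ω T) :
    ∏ v, leaderSign (A.status (A.run net ω T v)) = -1 := by
  obtain ⟨v, hv, hne⟩ := h
  have hone : ∀ u, u ≠ v → leaderSign (A.status (A.run net ω T u)) = 1 := fun u hu => by
    simp [leaderSign, hne u hu]
  rw [Fintype.prod_eq_single v hone, hv, leaderSign, if_pos rfl]

/-- The sign, after `T` rounds, of a node that never receives a message. -/
noncomputable def silentSign (n id d T : ℕ) (c : ℕ → Bool) : ℝ :=
  leaderSign (A.status (A.silentRun n id d c T))

lemma integral_silentSign (n id d T : ℕ) : ∫ c, A.silentSign n id d T c ∂tapeMeasure =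
    1 - 2 * tapeMeasure.real {c | A.status (A.silentRun n id d c T) = .elected} := by
  have hS := A.measurableSet_status_silentRun n id d T .elected
  set S := {c | A.status (A.silentRun n id d c T) = .elected}
  have hsign : ∀ c, A.silentSign n id d T c = 1 - 2 * S.indicator (1 : (ℕ → Bool) → ℝ) c := by
    intro c
    simp only [silentSign, leaderSign, Set.indicator, S, Set.mem_ofPred_eq, Pi.one_apply]
    split_ifs <;> norm_num
  simp only [hsign]
  rw [integral_sub (integrable_const _) (((integrable_const 1).indicator hS).const_mul 2),
    integral_const_mul, integral_indicator_one hS]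
  simp

section Twin

variable {m k N : ℕ}

/-- The product of the signs of the private nodes of a clique after `T` rounds. -/
noncomputable def privateSign (net : Network (m + k + 1) N) (T : ℕ) (p : Placement m k)
    (ω : Fin (m + k + 1) → ℕ → Bool) : ℝ :=
  ∏ a, leaderSign (A.status (A.run net ω T (p (.inr a))))

/-- The mean of `privateSign` over the coin flips and the placement. -/
noncomputable def bias (m k : ℕ) (net : Network (m + k + 1) N) (T : ℕ) : ℝ :=
  𝔼 p : Placement m k, ∫ ω, A.privateSign net T p ω ∂coinMeasure (m + k + 1)

/-- The product of the signs of all nodes of the twin cliques after `T` rounds, as long as no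
message crosses a hub. -/
noncomputable def uncrossedSign (ids : Source m k ↪ Set.Icc 1 N) (x : Bool → Placement m k) (T : ℕ)
    (ω : SourceCoins m k) : ℝ :=
  ∏ v, leaderSign (A.status (A.uncrossedRun ids x ω T v))

variable (ids : Source m k ↪ Set.Icc 1 N) (x : Bool → Placement m k) (T : ℕ)

lemma uncrossedSign_eq (ω : SourceCoins m k) : A.uncrossedSign ids x T ω =
    (∏ s, (A.withSize (2 * m + k + 1)).privateSign (sideClique ids s) T (x s) (ω.1 s)) *
      ∏ j, A.silentSign (2 * m + k + 1) (ids (.inr j)) (2 * m + k) T (ω.2 j) := by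
  rw [uncrossedSign, Fintype.prod_sum_type, Fintype.prod_prod_type, mul_comm]
  rfl

lemma abs_uncrossedSign (ω : SourceCoins m k) : |A.uncrossedSign ids x T ω| = 1 := by
  simp only [uncrossedSign, Finset.abs_prod, abs_leaderSign, Finset.prod_const_one]

lemma measurable_uncrossedSign : Measurable (A.uncrossedSign ids x T) := by
  refine Finset.measurable_prod _ fun v _ => A.measurable_leaderSign.comp ?_
  rcases v with j | ⟨s, a⟩
  · exact (A.measurable_silentRun _ _ _ T).comp ((measurable_pi_apply j).comp measurable_snd)
  · exact ((A.withSize _).measurable_run _ T _).comp ((measurable_pi_apply s).comp measurable_fst)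

lemma integral_uncrossedSign : ∫ ω, A.uncrossedSign ids x T ω ∂sourceMeasure m k =
    (∏ s, ∫ ω, (A.withSize (2 * m + k + 1)).privateSign (sideClique ids s) T (x s) ω
        ∂coinMeasure (m + k + 1)) *
      ∏ j, ∫ c, A.silentSign (2 * m + k + 1) (ids (.inr j)) (2 * m + k) T c ∂tapeMeasure := by
  let F s := (A.withSize (2 * m + k + 1)).privateSign (sideClique ids s) T (x s)
  let G j := A.silentSign (2 * m + k + 1) (ids (.inr j)) (2 * m + k) T
  calc ∫ ω, A.uncrossedSign ids x T ω ∂sourceMeasure m k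
      = ∫ ω, (∏ s, F s (ω.1 s)) * ∏ j, G j (ω.2 j) ∂sourceMeasure m k := by
        simp only [uncrossedSign_eq, F, G]
    _ = (∫ ω, ∏ s, F s (ω s) ∂Measure.pi fun _ => coinMeasure (m + k + 1)) *
          ∫ ω, ∏ j, G j (ω j) ∂coinMeasure (k + 1) :=
        integral_prod_mul (fun ω : Bool → Fin (m + k + 1) → ℕ → Bool => ∏ s, F s (ω s))
          fun ω : Fin (k + 1) → ℕ → Bool => ∏ j, G j (ω j)
    _ = _ := congrArg₂ (· * ·) (integral_fintype_prod_eq_prod F) (integral_fintype_prod_eq_prod G)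

lemma expect_integral_uncrossedSign :
    𝔼 x : Bool → Placement m k, ∫ ω, A.uncrossedSign ids x T ω ∂sourceMeasure m k =
      (∏ s, (A.withSize (2 * m + k + 1)).bias m k (sideClique ids s) T) *
        ∏ j, ∫ c, A.silentSign (2 * m + k + 1) (ids (.inr j)) (2 * m + k) T c ∂tapeMeasure := by
  simp only [integral_uncrossedSign, ← Finset.expect_mul]
  congr 1
  exact expect_prod_apply fun s (p : Placement m k) => ∫ ω,
    (A.withSize (2 * m + k + 1)).privateSign (sideClique ids s) T p ω ∂coinMeasure (m + k + 1)

end Twin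

end Algorithm

/-! ### The success probability on twin cliques -/

namespace Algorithm

section Success

variable {m k N : ℕ} {A : Algorithm} {ids : Source m k ↪ Set.Icc 1 N} {T : ℕ}

lemma measurable_sideMessages (A : Algorithm) (ids : Source m k ↪ Set.Icc 1 N) (T : ℕ) :
    Measurable fun ω => A.sideMessages ids ω T :=
  Finset.measurable_sum _ fun s _ =>
    ((A.withSize _).measurable_messagesBefore _ T).comp <|
      (measurable_pi_apply s).comp measurable_fst

lemma measurable_hubTraffic (A : Algorithm) (ids : Source m k ↪ Set.Icc 1 N)
    (x : Bool → Placement m k) (T : ℕ) : Measurable fun ω => A.hubTraffic ids x ω T :=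
  Finset.measurable_sum _ fun s _ => Finset.measurable_sum _ fun _ _ =>
    ((A.withSize _).measurable_traffic _ T _).comp ((measurable_pi_apply s).comp measurable_fst)

lemma measureReal_not_hubsQuiet_le (A : Algorithm) (ids : Source m k ↪ Set.Icc 1 N) (T : ℕ) :
    (sourceMeasure m k).real {ω | ¬ A.HubsQuiet ids T ω} ≤ ∑ j, tapeMeasure.real
      {c | ¬ A.Quiet (2 * m + k + 1) (ids (.inr j)) (2 * m + k) T c} := by
  have hmp : ∀ j, MeasurePreserving (fun ω : SourceCoins m k => ω.2 j) (sourceMeasure m k)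
      tapeMeasure := fun j =>
    (measurePreserving_eval (fun _ : Fin (k + 1) => tapeMeasure) j).comp measurePreserving_snd
  have hunion : {ω | ¬ A.HubsQuiet ids T ω} = ⋃ j, (fun ω : SourceCoins m k => ω.2 j) ⁻¹'
      {c | ¬ A.Quiet (2 * m + k + 1) (ids (.inr j)) (2 * m + k) T c} := by
    ext ω
    simp [HubsQuiet]
  rw [hunion]
  refine (measureReal_iUnion_fintype_le _).trans_eq (Finset.sum_congr rfl fun j _ => ?_)
  exact (hmp j).measureReal_preimage (A.measurableSet_not_quiet _ _ _ T).nullMeasurableSet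

lemma measureReal_hubsQuiet_le {b κ : ℝ} (hb : 0 ≤ b) (hκ : 0 < κ)
    (hsmall : 2 * (k + 1) / (m + k + 1) * (1 + κ) ≤ (1 / 2 : ℝ))
    (h : ∀ x, A.expectedMessages (twinCliques ids x) ≤ ENNReal.ofReal b) :
    (sourceMeasure m k).real {ω | A.HubsQuiet ids T ω ∧ κ ≤ A.sideMessages ids ω T} ≤
      2 * b / κ := by
  let f (x : Bool → Placement m k) (ω : SourceCoins m k) : ℝ :=
    A.messagesBefore (twinCliques ids x) (twinCoins x ω) T
  have hf : ∀ x, Integrable (fun ω => (A.messagesBefore (twinCliques ids x) ω T : ℝ))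
      (coinMeasure (2 * m + k + 1)) := fun x =>
    A.integrable_messagesBefore ((h x).trans_lt ENNReal.ofReal_lt_top).ne T
  have hint : ∀ x, Integrable (f x) (sourceMeasure m k) := fun x =>
    (measurePreserving_twinCoins x).integrable_comp_of_integrable (hf x)
  have hmean : ∀ x, ∫ ω, f x ω ∂sourceMeasure m k ≤ b := fun x => by
    have hmp := measurePreserving_twinCoins x
    rw [← hmp.map_eq] at hf
    rw [← integral_map hmp.aemeasurable (hf x).aestronglyMeasurable, hmp.map_eq]
    exact A.integral_messagesBefore_le hb (h x) T
  have hmarkov := mul_meas_ge_le_integral_of_nonneg (μ := sourceMeasure m k)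
    (f := fun ω => 𝔼 x, f x ω)
    (.of_forall fun ω => Finset.expect_nonneg fun x _ => Nat.cast_nonneg _)
    (by simpa only [Fintype.expect_eq_sum_div_card] using
      (integrable_finsetSum _ fun x _ => hint x).div_const _) (κ / 2)
  rw [integral_expect hint] at hmarkov
  rw [le_div_iff₀ hκ]
  have hsub : {ω | A.HubsQuiet ids T ω ∧ κ ≤ A.sideMessages ids ω T} ⊆
      {ω | κ / 2 ≤ 𝔼 x, f x ω} := fun ω hω =>
    half_le_expect_messagesBefore hκ hsmall hω.1 hω.2
  have hle := mul_le_mul_of_nonneg_left (measureReal_mono (μ := sourceMeasure m k) hsub) hκ.le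
  linarith [Finset.expect_le Finset.univ_nonempty fun x _ => hmean x]

lemma expect_measureReal_hubTraffic_le (A : Algorithm) (ids : Source m k ↪ Set.Icc 1 N) (T : ℕ)
    {κ : ℝ} (hκ : 0 < κ) :
    𝔼 x, (sourceMeasure m k).real
        {ω | (A.sideMessages ids ω T : ℝ) < κ ∧ A.hubTraffic ids x ω T ≠ 0} ≤
      2 * (k + 1) / (m + k + 1) * κ := by
  have hmeas : Measurable fun ω => (A.sideMessages ids ω T : ℝ) :=
    measurable_from_nat.comp (A.measurable_sideMessages ids T)
  refine expect_measureReal_le _ (fun x => ?_) fun ω => ?_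
  · exact (measurableSet_lt hmeas measurable_const).inter
      ((A.measurable_hubTraffic ids x T) (measurableSet_singleton 0)).compl
  · by_cases hω : (A.sideMessages ids ω T : ℝ) < κ
    · calc _ ≤ 𝔼 x : Bool → Placement m k, (A.hubTraffic ids x ω T : ℝ) := by
            refine Finset.expect_le_expect fun x _ =>
              Set.indicator_apply_le' (fun hx => ?_) fun _ => Nat.cast_nonneg _
            change (1 : ℝ) ≤ _
            exact_mod_cast Nat.one_le_iff_ne_zero.mpr hx.2
        _ = 2 * (k + 1) / (m + k + 1) * A.sideMessages ids ω T := expect_hubTraffic A ids ω T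
        _ ≤ _ := by gcongr
    · calc _ = 𝔼 _x : Bool → Placement m k, (0 : ℝ) := Finset.expect_congr rfl fun x _ =>
            Set.indicator_of_notMem (fun hx => hω hx.1) _
        _ ≤ _ := by rw [Finset.expect_const_zero]; positivity

lemma expect_measureReal_uncrossedSign_le
    (hbias : 0 ≤ ∏ s, (A.withSize (2 * m + k + 1)).bias m k (sideClique ids s) T)
    (hhub : ∀ j, tapeMeasure.real {c | A.status
      (A.silentRun (2 * m + k + 1) (ids (.inr j)) (2 * m + k) c T) = .elected} ≤ 1 / 2) :
    𝔼 x, (sourceMeasure m k).real {ω | A.uncrossedSign ids x T ω = -1} ≤ 1 / 2 := by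
  have hmean : 0 ≤ 𝔼 x, ∫ ω, A.uncrossedSign ids x T ω ∂sourceMeasure m k := by
    rw [expect_integral_uncrossedSign]
    refine mul_nonneg hbias (Finset.prod_nonneg fun j _ => ?_)
    rw [integral_silentSign]
    linarith [hhub j]
  have hle := Finset.expect_le_expect fun x (_ : x ∈ Finset.univ) =>
    measureReal_eq_neg_one_le (sourceMeasure m k) (A.measurable_uncrossedSign ids x T)
      fun ω => (A.abs_uncrossedSign ids x T ω).le
  rw [← Finset.expect_div, Finset.expect_sub_distrib, Fintype.expect_const] at hle
  linarith

lemma uncrossedSign_eq_neg_one {x : Bool → Placement m k} {ω : SourceCoins m k}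
    (hq : A.HubsQuiet ids T ω) (hx : A.hubTraffic ids x ω T = 0)
    (h : A.OneLeader (twinCliques ids x) (twinCoins x ω) T) : A.uncrossedSign ids x T ω = -1 := by
  rw [← prod_leaderSign_of_oneLeader h, ← (twinEnum m k).prod_comp]
  simp only [run_twinCliques hq hx le_rfl, uncrossedSign]

lemma measureReal_oneLeader_twinCliques_le (A : Algorithm) (ids : Source m k ↪ Set.Icc 1 N) (T : ℕ)
    (x : Bool → Placement m k) (κ : ℝ) :
    (coinMeasure (2 * m + k + 1)).real {ω | A.OneLeader (twinCliques ids x) ω T} ≤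
      (sourceMeasure m k).real {ω | A.uncrossedSign ids x T ω = -1} +
      (sourceMeasure m k).real {ω | ¬ A.HubsQuiet ids T ω} +
      (sourceMeasure m k).real {ω | A.HubsQuiet ids T ω ∧ κ ≤ A.sideMessages ids ω T} +
      (sourceMeasure m k).real
        {ω | (A.sideMessages ids ω T : ℝ) < κ ∧ A.hubTraffic ids x ω T ≠ 0} := by
  rw [← (measurePreserving_twinCoins x).measureReal_preimage
    (A.measurableSet_oneLeader _ T).nullMeasurableSet]
  refine (measureReal_mono fun ω hω => ?_).trans <| (measureReal_union_le _ _).trans <|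
    add_le_add_left ((measureReal_union_le _ _).trans <|
      add_le_add_left (measureReal_union_le _ _) _) _
  by_cases hq : A.HubsQuiet ids T ω
  · by_cases hκ : (A.sideMessages ids ω T : ℝ) < κ
    · by_cases hx : A.hubTraffic ids x ω T = 0
      · exact .inl (.inl (.inl (uncrossedSign_eq_neg_one hq hx hω)))
      · exact .inr ⟨hκ, hx⟩
    · exact .inl (.inr ⟨hq, not_lt.mp hκ⟩)
  · exact .inl (.inl (.inr hq))

lemma advantage_le {b δ η κ : ℝ} (hb : 0 ≤ b) (hκ : 0 < κ)
    (hsmall : 2 * (k + 1) / (m + k + 1) * (1 + κ) ≤ (1 / 2 : ℝ))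
    (hmsg : ∀ x, A.expectedMessages (twinCliques ids x) ≤ ENNReal.ofReal b)
    (hT : ∀ x, 1 / 2 + δ ≤
      (coinMeasure (2 * m + k + 1)).real {ω | A.OneLeader (twinCliques ids x) ω T})
    (hbias : 0 ≤ ∏ s, (A.withSize (2 * m + k + 1)).bias m k (sideClique ids s) T)
    (hhub : ∀ j, tapeMeasure.real {c | A.status
      (A.silentRun (2 * m + k + 1) (ids (.inr j)) (2 * m + k) c T) = .elected} ≤ 1 / 2)
    (hquiet : ∀ j, tapeMeasure.real
      {c | ¬ A.Quiet (2 * m + k + 1) (ids (.inr j)) (2 * m + k) T c} ≤ η) :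
    δ ≤ (k + 1) * η + 2 * b / κ + 2 * (k + 1) / (m + k + 1) * κ := by
  have hle := Finset.expect_le_expect fun x (_ : x ∈ Finset.univ) =>
    (hT x).trans (measureReal_oneLeader_twinCliques_le A ids T x κ)
  simp only [Finset.expect_add_distrib, Fintype.expect_const] at hle
  have hquiet' := (measureReal_not_hubsQuiet_le A ids T).trans
    (Finset.sum_le_sum fun j _ => hquiet j)
  simp only [Finset.sum_const, Finset.card_univ, Fintype.card_fin, nsmul_eq_mul] at hquiet'
  push_cast at hquiet'
  linarith [expect_measureReal_uncrossedSign_le hbias hhub,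
    measureReal_hubsQuiet_le (T := T) hb hκ hsmall hmsg,
    expect_measureReal_hubTraffic_le A ids T hκ]

end Success

end Algorithm

/-! ### The lower bound -/

section LowerBound

variable {m k N : ℕ}

/-- The IDs of three cliques on `m + k + 1` nodes, and of one clique on `2 * m + k + 1` nodes for
every hub. All IDs are distinct, so that any two of the small cliques and one node of each large
clique can be combined to twin cliques. -/
abbrev IDPool (m k N : ℕ) : Type :=
  Fin 3 × Fin (m + k + 1) ⊕ Fin (k + 1) × Fin (2 * m + k + 1) ↪ Set.Icc 1 N

namespace IDPool

lemma nonempty (hk : k ≤ 1) (hN : 5 * (2 * m + k + 1) ≤ N) : Nonempty (IDPool m k N) := by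
  have hhubs : (k + 1) * (2 * m + k + 1) ≤ 2 * (2 * m + k + 1) := by gcongr; omega
  apply Function.Embedding.nonempty_of_card_le
  simp only [Fintype.card_sum, Fintype.card_prod, Fintype.card_fin, Fintype.card_ofFinset,
    Nat.card_Icc]
  omega

variable (p : IDPool m k N)

/-- The small clique with number `i`. -/
noncomputable def smallClique (i : Fin 3) : Network (m + k + 1) N :=
  clique ⟨fun u => p (.inl (i, u)),
    p.injective.comp (Sum.inl_injective.comp (Prod.mk_right_injective i))⟩

/-- The large clique for the hub `j`. -/
noncomputable def largeClique (j : Fin (k + 1)) : Network (2 * m + k + 1) N :=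
  clique ⟨fun v => p (.inr (j, v)),
    p.injective.comp (Sum.inr_injective.comp (Prod.mk_right_injective j))⟩

/-- The IDs of twin cliques made of two small cliques, one for either side, and of one node from
each large clique as a hub. -/
def twinIds (side : Bool ↪ Fin 3) (hub : Fin (k + 1) → Fin (2 * m + k + 1)) :
    Source m k ↪ Set.Icc 1 N :=
  (Function.Embedding.sumMap (side.prodMap (.refl _))
    ⟨fun j => (j, hub j), fun _ _ h => congrArg Prod.fst h⟩).trans p

end IDPool

namespace Algorithm

variable {A : Algorithm} {b δ : ℝ} {T : ℕ}

lemma exists_twinIds (p : IDPool m k N) {η : ℝ} (hb : 0 ≤ b) (hη : 0 < η)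
    (hmsg : ∀ j, A.expectedMessages (p.largeClique j) ≤ ENNReal.ofReal b)
    (hT : ∀ j, 1 / 2 + δ ≤
      (coinMeasure (2 * m + k + 1)).real {ω | A.OneLeader (p.largeClique j) ω T})
    (hn : 1 + 2 * b * (1 + 1 / (2 * η)) < δ * (2 * m + k + 1 : ℕ)) :
    ∃ ids : Source m k ↪ Set.Icc 1 N,
      0 ≤ ∏ s, (A.withSize (2 * m + k + 1)).bias m k (sideClique ids s) T ∧
      (∀ j, tapeMeasure.real {c | A.status
        (A.silentRun (2 * m + k + 1) (ids (.inr j)) (2 * m + k) c T) = .elected} ≤ 1 / 2) ∧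
      ∀ j, tapeMeasure.real
        {c | ¬ A.Quiet (2 * m + k + 1) (ids (.inr j)) (2 * m + k) T c} ≤ η := by
  obtain ⟨i, i', hne, hbias⟩ := exists_mul_nonneg fun i =>
    (A.withSize (2 * m + k + 1)).bias m k (p.smallClique i) T
  choose hub hhub hquiet using fun j => exists_quiet_node A hb hη (hmsg j) (hT j) hn
  let side : Bool ↪ Fin 3 := ⟨fun s => cond s i i', by
    rintro (_ | _) (_ | _) h
    exacts [rfl, absurd h.symm hne, absurd h hne, rfl]⟩
  refine ⟨p.twinIds side hub, ?_, hhub, hquiet⟩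
  rw [Fintype.prod_bool]
  exact hbias

lemma advantage_le_of_idPool (p : IDPool m k N) {η κ : ℝ} (hb : 0 ≤ b) (hη : 0 < η) (hκ : 0 < κ)
    (hmsg : ∀ net : Network (2 * m + k + 1) N, net.graph.ediam ≤ 2 →
      A.expectedMessages net ≤ ENNReal.ofReal b)
    (hT : ∀ net : Network (2 * m + k + 1) N, net.graph.ediam ≤ 2 →
      1 / 2 + δ ≤ (coinMeasure (2 * m + k + 1)).real {ω | A.OneLeader net ω T})
    (hn : 1 + 2 * b * (1 + 1 / (2 * η)) < δ * (2 * m + k + 1 : ℕ))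
    (hsmall : 2 * (k + 1) / (m + k + 1) * (1 + κ) ≤ (1 / 2 : ℝ)) :
    δ ≤ (k + 1) * η + 2 * b / κ + 2 * (k + 1) / (m + k + 1) * κ := by
  obtain ⟨ids, hbias, hhub, hquiet⟩ := exists_twinIds p hb hη
    (fun _ => hmsg _ (ediam_clique_le_two _)) (fun _ => hT _ (ediam_clique_le_two _)) hn
  exact advantage_le hb hκ hsmall (fun _ => hmsg _ (ediam_twinCliques_le_two _ _))
    (fun _ => hT _ (ediam_twinCliques_le_two _ _)) hbias hhub hquiet

lemma exists_le_expectedMessages {ε : ℝ} (hε : 0 < ε) (hk : k ≤ 1)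
    (hn : 32 / ε ≤ (2 * m + k + 1 : ℕ)) (hN : 5 * (2 * m + k + 1) ≤ N)
    (hA : ∀ net : Network (2 * m + k + 1) N, net.graph.ediam ≤ 2 →
      1 / 2 + ε ≤ A.successProb net) :
    ∃ net : Network (2 * m + k + 1) N, net.graph.ediam ≤ 2 ∧
      ENNReal.ofReal (ε ^ 2 / 1024 * (2 * m + k + 1 : ℕ)) ≤ A.expectedMessages net := by
  by_contra! hmsg
  obtain ⟨T, hT⟩ := exists_round_oneLeader A (show 1 / 2 + ε / 2 < 1 / 2 + ε by linarith) hA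
  obtain ⟨p⟩ := IDPool.nonempty hk hN
  have hε1 : ε ≤ 1 := by
    linarith [(hT _ (ediam_clique_le_two _ : (p.largeClique 0).graph.ediam ≤ 2)).trans
      measureReal_le_one]
  set n := ((2 * m + k + 1 : ℕ) : ℝ) with hn_def
  set M : ℝ := m + k + 1 with hM_def
  have hk1 : (k : ℝ) + 1 ≤ 2 := by norm_cast; omega
  have hnM : n ≤ 2 * M := by push_cast [hn_def, hM_def]; linarith
  have hεn : 32 ≤ ε * n := by rwa [div_le_iff₀' hε] at hn
  have hM : 16 ≤ M := by nlinarith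
  have hfew : 1 + 2 * (ε ^ 2 / 1024 * n) * (1 + 1 / (2 * (ε / 32))) < ε / 2 * n := by
    have : 2 * (ε ^ 2 / 1024 * n) * (1 + 1 / (2 * (ε / 32))) = ε * n * (ε / 512 + 1 / 32) := by
      field_simp
      ring
    nlinarith
  have hsmall : 2 * (k + 1) / M * (1 + ε * M / 32) ≤ 1 / 2 := by
    rw [div_mul_eq_mul_div, div_le_iff₀ (by positivity)]
    calc 2 * ((k : ℝ) + 1) * (1 + ε * M / 32) ≤ 2 * 2 * (1 + 1 * M / 32) := by gcongr
      _ ≤ 1 / 2 * M := by linarith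
  have hadv := advantage_le_of_idPool p (η := ε / 32) (κ := ε * M / 32) (by positivity)
    (by positivity) (by positivity) (fun net hnet => (hmsg net hnet).le) hT hfew hsmall
  have hlimit : 2 * (ε ^ 2 / 1024 * n) / (ε * M / 32) ≤ ε / 8 := by
    rw [div_le_iff₀ (by positivity)]
    nlinarith
  have hcross : 2 * (k + 1) / M * (ε * M / 32) = (k + 1) * ε / 16 := by field_simp; norm_num
  nlinarith

end Algorithm

end LowerBound

end LeaderElection

theorem theorem2_general (ε : ℝ) (hε : 0 < ε) :
    ∃ c : ℝ, 0 < c ∧ ∃ n₀ : ℕ, ∀ n : ℕ, n₀ ≤ n → ∀ N : ℕ, 5 * n ≤ N →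
      ∀ A : LeaderElection.Algorithm,
        (∀ net : LeaderElection.Network n N, net.graph.ediam ≤ 2 →
          1 / 2 + ε ≤ A.successProb net) →
        ∃ net : LeaderElection.Network n N, net.graph.ediam ≤ 2 ∧
          ENNReal.ofReal (c * n) ≤ A.expectedMessages net := by
  refine ⟨ε ^ 2 / 1024, by positivity, ⌈32 / ε⌉₊, fun n hn N hN A hA => ?_⟩
  have hn_pos : 0 < n := (Nat.ceil_pos.mpr (by positivity)).trans_le hn
  obtain ⟨m, k, hk, rfl⟩ : ∃ m k, k ≤ 1 ∧ n = 2 * m + k + 1 :=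
    ⟨(n - 1) / 2, (n - 1) % 2, by omega, by omega⟩
  exact LeaderElection.Algorithm.exists_le_expectedMessages hε hk (Nat.ceil_le.mp hn) hN hA

theorem theorem2 (ε : ℝ) (hε : 0 < ε) :
    ∃ c : ℝ, 0 < c ∧ ∃ n₀ : ℕ, ∀ n : ℕ, n₀ ≤ n → ∀ N : ℕ, n ^ 4 ≤ N →
      ∀ A : LeaderElection.Algorithm,
        (∀ net : LeaderElection.Network n N, net.graph.ediam ≤ 2 →
          1 / 2 + ε ≤ A.successProb net) →
        ∃ net : LeaderElection.Network n N, net.graph.ediam ≤ 2 ∧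
          ENNReal.ofReal (c * n) ≤ A.expectedMessages net := by
  obtain ⟨c, hc, n₀, h⟩ := theorem2_general ε hε
  have hpow (n : ℕ) (hn : 2 ≤ n) : 5 * n ≤ n ^ 4 := by
    linarith [Nat.mul_le_mul_right n ((by norm_num : 5 ≤ 2 ^ 3).trans (Nat.pow_le_pow_left hn 3))]
  exact ⟨c, hc, max n₀ 2, fun n hn N hN =>
    h n (le_of_max_le_left hn) N ((hpow n (le_of_max_le_right hn)).trans hN)⟩
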